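/- Identify $M_2$ with the complex $2\times 2$ matrices with operator norm, with standard basis $e_1,e_2$ of $\mathbb{C}^2$ and matrix units $E_{ij}=|e_i\rangle\langle e_j|$, and let $D_2\subset M_2$ be the diagonal matrices. For a linear map $\phi:M_2\to M_2$ let $\rho_\phi=\sum_{i,j}E_{ij}\otimes\phi(E_{ij})$ be its Choi matrix. Let $\pi$ be the projective norm on $M_2\otimes M_2$, $$\pi(z)=\inf\Big\{\sum_i\|a_i\|\,\|b_i\|_1 : z=\sum_i a_i\otimes b_i\Big\}$$ ($\|\cdot\|_1$ is the trace norm), let $\alpha(\rho)=\sup_{z\ne0}|\operatorname{Tr}\rho z|/\pi(z)$ be its dual norm, and let $$\mathfrak D=\{\rho\in M_2\otimes M_2:\ \rho=\rho^*,\ \alpha(\rho)=1,\ \langle x\otimes y,\rho\,(x\otimes y)\rangle\ge0\ \ \forall x,y\in\mathbb{C}^2,\ \operatorname{Tr}\rho=2\}.$$ A linear map $\phi:M_2\to M_2$ is called a *regular extreme normalized unital map* if it is an extreme point of the convex set of positive (or of the convex set of completely positive) linear maps $\phi:M_2\to M_2$ with $\phi(1)=1$ and $\|\phi\|=1$, and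 if its restriction $\phi|_{D_2}$ is an extreme point of the convex set of unital completely positive maps $D_2\to M_2$. **Theorem.** Consider the following matrices in $M_2\otimes M_2$: 1. the symmetries in $\mathfrak D$, i.e. the $s\in\mathfrak D$ with $s=s^*$ and $s^2=1$; 2. $2P_x$, where $P_x=|x\rangle\langle x|$ and $x=\tfrac1{\sqrt2}(u_1\otimes v_1+u_2\otimes v_2)$ is maximally entangled ($u$, $v$ orthonormal bases of $\mathbb{C}^2$); 3. $p\otimes 1$, where $p$ is a rank one orthogonal projector in $M_2$; 4. $\rho_{\tilde\phi}=E_{11}\otimes|y_1\rangle\langle y_1|+E_{22}\otimes|y_2\rangle\langle y_2|$, where $\{y_1,y_2\}$ is an orthonormal basis of $\mathbb{C}^2$. All of these matrices belong to $\mathfrak D$, and for every regular extreme normalized unital map $\phi$ the Choi matrix $\rho_\phi$ is one of them. -/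

import Mathlib

open scoped Matrix Kronecker ComplexOrder MatrixOrder Matrix.Norms.L2Operator

noncomputable section

namespace RegularExtreme

/-! Throughout, `M_n` is `Matrix n n ℂ` with the operator norm of `ℂⁿ` (Euclidean), and
`M_n ⊗ M_n` is identified with `Matrix (n × n) (n × n) ℂ` through the Kronecker product. -/

variable {n m : Type} [Fintype n] [DecidableEq n] [Fintype m] [DecidableEq m]

/-- A linear map `M_n → M_m` is positive if it maps positive semidefinite matrices to positive
semidefinite matrices. -/
def IsPositiveMap (φ : Matrix n n ℂ →ₗ[ℂ] Matrix m m ℂ) : Prop :=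
  ∀ a : Matrix n n ℂ, a.PosSemidef → (φ a).PosSemidef

/-- A linear map from a unital subalgebra `S` of `M_n` to `M_m` is completely positive if for all
`k` its entrywise application to `k × k` matrices over `S` preserves positive semidefiniteness;
`Matrix.comp` turns a `k × k` matrix of `n × n` matrices into a `kn × kn` matrix. -/
def IsCompletelyPositiveOn (S : Subalgebra ℂ (Matrix n n ℂ)) (φ : S →ₗ[ℂ] Matrix m m ℂ) : Prop :=
  ∀ (k : ℕ) (A : Matrix (Fin k) (Fin k) S),
    (Matrix.comp (Fin k) (Fin k) n n ℂ (A.map fun a => (a : Matrix n n ℂ))).PosSemidef →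
      (Matrix.comp (Fin k) (Fin k) m m ℂ (A.map φ)).PosSemidef

/-- A linear map `M_n → M_m` is completely positive if for all `k` its entrywise application to
`k × k` matrices over `M_n` preserves positive semidefiniteness. -/
def IsCompletelyPositive (φ : Matrix n n ℂ →ₗ[ℂ] Matrix m m ℂ) : Prop :=
  ∀ (k : ℕ) (A : Matrix (Fin k) (Fin k) (Matrix n n ℂ)),
    (Matrix.comp (Fin k) (Fin k) n n ℂ A).PosSemidef →
      (Matrix.comp (Fin k) (Fin k) m m ℂ (A.map φ)).PosSemidef

/-- A linear map is normalized if its norm (with respect to the operator norms of matrices)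
equals one. -/
def IsNormalized (φ : Matrix n n ℂ →ₗ[ℂ] Matrix m m ℂ) : Prop :=
  ‖LinearMap.toContinuousLinearMap φ‖ = 1

variable (n) in
/-- The convex set of normalized unital positive maps on `M_n`. -/
def positiveMaps : Set (Matrix n n ℂ →ₗ[ℂ] Matrix n n ℂ) :=
  {φ | IsPositiveMap φ ∧ φ 1 = 1 ∧ IsNormalized φ}

variable (n) in
/-- The convex set of normalized unital completely positive maps on `M_n`. -/
def completelyPositiveMaps : Set (Matrix n n ℂ →ₗ[ℂ] Matrix n n ℂ) :=
  {φ | IsCompletelyPositive φ ∧ φ 1 = 1 ∧ IsNormalized φ}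

variable (n) in
/-- The algebra of diagonal `n × n` matrices. -/
def diagonalAlgebra : Subalgebra ℂ (Matrix n n ℂ) :=
  (Matrix.diagonalAlgHom ℂ : (n → ℂ) →ₐ[ℂ] Matrix n n ℂ).range

variable (n) in
/-- The convex set of unital completely positive maps from the diagonal matrices to `M_n`. -/
def diagonalMaps : Set (diagonalAlgebra n →ₗ[ℂ] Matrix n n ℂ) :=
  {φ | IsCompletelyPositiveOn (diagonalAlgebra n) φ ∧ φ 1 = 1}

/-- A regular extreme normalized unital map: an extreme point of the normalized unital positive
maps, or of the normalized unital completely positive maps, whose restriction to the diagonal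
matrices is an extreme point of the unital completely positive maps on the diagonal matrices. -/
def IsRegularExtreme (φ : Matrix n n ℂ →ₗ[ℂ] Matrix n n ℂ) : Prop :=
  (φ ∈ Set.extremePoints ℝ (positiveMaps n) ∨
    φ ∈ Set.extremePoints ℝ (completelyPositiveMaps n)) ∧
  φ ∘ₗ (diagonalAlgebra n).val.toLinearMap ∈ Set.extremePoints ℝ (diagonalMaps n)

/-- The Choi matrix `∑ᵢⱼ Eᵢⱼ ⊗ φ(Eᵢⱼ)`. -/
def choi (φ : Matrix n n ℂ →ₗ[ℂ] Matrix n n ℂ) : Matrix (n × n) (n × n) ℂ :=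
  ∑ i, ∑ j, Matrix.single i j (1 : ℂ) ⊗ₖ φ (Matrix.single i j 1)

/-- The trace norm `Tr (b* b)^{1/2}`. -/
def traceNorm (b : Matrix n n ℂ) : ℝ :=
  (Matrix.trace (CFC.sqrt (bᴴ * b))).re

/-- The projective norm on `M_n ⊗ M_n`, with the operator norm on the first factor and the trace
norm on the second. -/
def projectiveNorm (x : Matrix (n × n) (n × n) ℂ) : ℝ :=
  sInf {r | ∃ (k : ℕ) (a b : Fin k → Matrix n n ℂ),
    x = ∑ i, a i ⊗ₖ b i ∧ r = ∑ i, ‖a i‖ * traceNorm (b i)}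

/-- The norm dual to the projective norm under the pairing `(ρ, a) ↦ Tr (ρ a)`. -/
def alphaNorm (ρ : Matrix (n × n) (n × n) ℂ) : ℝ :=
  sSup {r | ∃ a : Matrix (n × n) (n × n) ℂ, a ≠ 0 ∧ r = ‖(ρ * a).trace‖ / projectiveNorm a}

/-- Block positivity: `⟨x ⊗ y, ρ (x ⊗ y)⟩ ≥ 0` for all `x, y ∈ ℂⁿ`. -/
def IsBlockPositive (ρ : Matrix (n × n) (n × n) ℂ) : Prop :=
  ∀ x y : n → ℂ,
    0 ≤ (star fun p : n × n => x p.1 * y p.2) ⬝ᵥ (ρ *ᵥ fun p : n × n => x p.1 * y p.2)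

variable (n) in
/-- The set `𝔇` of Choi matrices of normalized unital positive maps: selfadjoint block positive
matrices of `α`-norm `1` and trace `n`. -/
def setD : Set (Matrix (n × n) (n × n) ℂ) :=
  {ρ | ρ.IsHermitian ∧ alphaNorm ρ = 1 ∧ IsBlockPositive ρ ∧ ρ.trace = (Fintype.card n : ℂ)}

/-- A symmetry is a selfadjoint unitary. -/
def IsSymmetry (s : Matrix (n × n) (n × n) ℂ) : Prop :=
  s.IsHermitian ∧ s * s = 1

/-- A vector of `ℂⁿ ⊗ ℂⁿ` is maximally entangled if it is `n^{-1/2} ∑ᵢ uᵢ ⊗ vᵢ` for some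
orthonormal bases `u`, `v` of `ℂⁿ`. -/
def IsMaximallyEntangled (x : n × n → ℂ) : Prop :=
  ∃ u v : OrthonormalBasis n ℂ (EuclideanSpace ℂ n),
    ∀ p : n × n, x p = ((√(Fintype.card n : ℝ) : ℝ) : ℂ)⁻¹ * ∑ i, u i p.1 * v i p.2

/-- The operator `|x⟩⟨x|`, which is the orthogonal projector `P_x` when `x` is a unit vector. -/
def ketBra {ι : Type} (x : ι → ℂ) : Matrix ι ι ℂ :=
  Matrix.vecMulVec x (star x)

/-- A rank one orthogonal projector. -/
def IsRankOneProjector (p : Matrix n n ℂ) : Prop :=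
  p.IsHermitian ∧ p * p = p ∧ p.rank = 1

variable (n) in
/-- The set consisting of the symmetries in `𝔇`, the matrices `n P_x` with `x` maximally entangled,
and the matrices `p ⊗ 1` with `p` a rank one projector. -/
def setDTilde : Set (Matrix (n × n) (n × n) ℂ) :=
  {s | s ∈ setD n ∧ IsSymmetry s} ∪
    {ρ | ∃ x : n × n → ℂ, IsMaximallyEntangled x ∧ ρ = (Fintype.card n : ℂ) • ketBra x} ∪
    {ρ | ∃ p : Matrix n n ℂ, IsRankOneProjector p ∧ ρ = p ⊗ₖ (1 : Matrix n n ℂ)}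

/-- The block diagonal matrix `∑ᵢ Eᵢᵢ ⊗ |yᵢ⟩⟨yᵢ|`, for an orthonormal basis `y`. -/
def diagonalChoi (y : OrthonormalBasis n ℂ (EuclideanSpace ℂ n)) : Matrix (n × n) (n × n) ℂ :=
  ∑ i, Matrix.single i i (1 : ℂ) ⊗ₖ ketBra (y i)

end RegularExtreme

end

open scoped Matrix Kronecker ComplexOrder MatrixOrder Matrix.Norms.L2Operator

set_option linter.unusedSectionVars false

namespace RegularExtreme

variable {n m : Type} [Fintype n] [DecidableEq n] [Fintype m] [DecidableEq m]

/-! ### The trace norm and the operator norm -/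

/-! Membership in `setD` is a duality statement. Since Tr(ρ_φ (a ⊗ b)) = Tr(φ(aᵀ) b), a contraction
φ satisfies |Tr(ρ_φ z)| ≤ π(z), and unitality gives equality at z = 1. Hence every normalized unital
positive map has its Choi matrix in `setD` (`choi_mem_setD`), and each listed family is exhibited as
Choi matrices of such maps, except the symmetries, which lie in `setD` by definition.

For a regular extreme φ, put A = φ(E₀₀), so that φ(E₁₁) = 1 - A. Since A is the midpoint of A² and
2A - A², extremality on the diagonal algebra makes A a projector
(`isIdempotentElem_of_diagonalMap_mem_extremePoints`). If A is 0 or 1, positivity kills the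
off-diagonal blocks and ρ_φ = Eᵢᵢ ⊗ 1. If A has rank one, a unitary change of basis makes φ fix E₀₀
and E₁₁. Positivity then forces E₀₁ ↦ b E₀₁ + c E₁₀ with |b| + |c| ≤ 1, which displays φ as a convex
combination of two unitary conjugations and one conjugated transpose (`exists_eq_combination`).
Extremality makes φ one of the three: a conjugation gives 2P_x, a conjugated transpose gives a
symmetry. -/

theorem norm_map_star (a : Matrix n n ℂ) : ‖a.map star‖ ≤ ‖a‖ := by
  rw [Matrix.l2_opNorm_def (a.map star)]
  refine ContinuousLinearMap.opNorm_le_bound _ (norm_nonneg _) fun x => ?_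
  have h := Matrix.l2_opNorm_mulVec a (WithLp.toLp 2 (star x.ofLp))
  have e1 : ‖(WithLp.toLp 2 (star x.ofLp) : EuclideanSpace ℂ n)‖ = ‖x‖ := by
    simp [EuclideanSpace.norm_eq]
  rw [e1] at h
  refine le_trans (le_of_eq ?_) h
  simp only [EuclideanSpace.norm_eq]
  congr 1
  refine Finset.sum_congr rfl fun i _ => ?_
  have : (a *ᵥ star x.ofLp) i = star ((a.map star *ᵥ x.ofLp) i) := by
    simp [Matrix.mulVec, dotProduct]
  simp [this]

theorem norm_transpose_le (a : Matrix n n ℂ) : ‖aᵀ‖ ≤ ‖a‖ := by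
  have h := norm_map_star aᴴ
  rwa [Matrix.l2_opNorm_conjTranspose, show aᴴ.map star = aᵀ by ext; simp] at h

theorem norm_dotProduct_mulVec_le (a : Matrix n n ℂ) (x y : EuclideanSpace ℂ n) :
    ‖star x.ofLp ⬝ᵥ (a *ᵥ y.ofLp)‖ ≤ ‖a‖ * ‖x‖ * ‖y‖ := by
  have h := norm_inner_le_norm (𝕜 := ℂ) x (WithLp.toLp 2 (a *ᵥ y.ofLp))
  rw [EuclideanSpace.inner_eq_star_dotProduct, dotProduct_comm] at h
  refine h.trans ?_
  have := mul_le_mul_of_nonneg_left (Matrix.l2_opNorm_mulVec a y) (norm_nonneg x)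
  exact this.trans (le_of_eq (by ring))

theorem trace_eq_sum_orthonormalBasis (a : Matrix n n ℂ)
    (f : OrthonormalBasis n ℂ (EuclideanSpace ℂ n)) :
    a.trace = ∑ i, star (f i).ofLp ⬝ᵥ (a *ᵥ (f i).ofLp) := by
  have h := LinearMap.trace_eq_sum_inner (Matrix.toEuclideanLin a) f
  rw [show LinearMap.trace ℂ _ (Matrix.toEuclideanLin a) = a.trace by
    rw [Matrix.toEuclideanLin_eq_toLin_orthonormal, Matrix.trace_toLin_eq]] at h
  rw [h]
  refine Finset.sum_congr rfl fun i _ => ?_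
  rw [EuclideanSpace.inner_eq_star_dotProduct, dotProduct_comm]
  rfl

theorem norm_mulVec_sq (b : Matrix n n ℂ) (y : EuclideanSpace ℂ n) :
    ((‖(WithLp.toLp 2 (b *ᵥ y.ofLp) : EuclideanSpace ℂ n)‖ ^ 2 : ℝ) : ℂ) =
      star y.ofLp ⬝ᵥ ((bᴴ * b) *ᵥ y.ofLp) := by
  have h := inner_self_eq_norm_sq_to_K (𝕜 := ℂ)
    (WithLp.toLp 2 (b *ᵥ y.ofLp) : EuclideanSpace ℂ n)
  rw [EuclideanSpace.inner_eq_star_dotProduct] at h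
  push_cast
  refine Eq.trans h.symm ?_
  rw [← Matrix.mulVec_mulVec, Matrix.dotProduct_mulVec, ← Matrix.star_mulVec, dotProduct_comm]

/-- The trace is expanded in an eigenbasis fᵢ of |b|. There ‖b fᵢ‖ is the i-th eigenvalue of |b|, so
each term is at most ‖a‖ times that eigenvalue. -/
theorem norm_trace_mul_le (a b : Matrix n n ℂ) : ‖(a * b).trace‖ ≤ ‖a‖ * traceNorm b := by
  have hpsd : (CFC.sqrt (bᴴ * b)).PosSemidef :=
    Matrix.nonneg_iff_posSemidef.mp (CFC.sqrt_nonneg _)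
  have hsq : CFC.sqrt (bᴴ * b) * CFC.sqrt (bᴴ * b) = bᴴ * b :=
    CFC.sqrt_mul_sqrt_self _
      (Matrix.nonneg_iff_posSemidef.mpr (Matrix.posSemidef_conjTranspose_mul_self b))
  unfold traceNorm
  set h := CFC.sqrt (bᴴ * b)
  set f := hpsd.1.eigenvectorBasis
  have hev (i) : h *ᵥ (f i).ofLp = hpsd.1.eigenvalues i • (f i).ofLp :=
    hpsd.1.mulVec_eigenvectorBasis i
  have hn (i) : star (f i).ofLp ⬝ᵥ (f i).ofLp = 1 := by
    have := inner_self_eq_norm_sq_to_K (𝕜 := ℂ) (f i)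
    rw [EuclideanSpace.inner_eq_star_dotProduct, dotProduct_comm, f.norm_eq_one] at this
    simpa using this
  have hb (i) : ‖(WithLp.toLp 2 (b *ᵥ (f i).ofLp) : EuclideanSpace ℂ n)‖ =
      hpsd.1.eigenvalues i := by
    have h1 := norm_mulVec_sq b (f i)
    rw [← hsq, ← Matrix.mulVec_mulVec, hev, Matrix.mulVec_smul, hev, smul_smul, dotProduct_smul,
      hn] at h1
    have h2 : ‖(WithLp.toLp 2 (b *ᵥ (f i).ofLp) : EuclideanSpace ℂ n)‖ ^ 2 =
      hpsd.1.eigenvalues i ^ 2 := by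
      apply Complex.ofReal_injective
      rw [h1]; simp [sq]
    exact (sq_eq_sq₀ (norm_nonneg _) (hpsd.eigenvalues_nonneg i)).mp h2
  rw [hpsd.1.trace_eq_sum_eigenvalues, trace_eq_sum_orthonormalBasis _ f, Complex.re_sum,
    Finset.mul_sum]
  refine (norm_sum_le _ _).trans (Finset.sum_le_sum fun i _ => ?_)
  rw [← Matrix.mulVec_mulVec]
  have := norm_dotProduct_mulVec_le a (f i) (WithLp.toLp 2 (b *ᵥ (f i).ofLp))
  rw [hb, f.norm_eq_one, mul_one] at this
  exact this

theorem traceNorm_of_posSemidef {b : Matrix n n ℂ} (hb : b.PosSemidef) :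
    traceNorm b = b.trace.re := by
  rw [traceNorm, hb.1.eq, CFC.sqrt_mul_self b (Matrix.nonneg_iff_posSemidef.mpr hb)]

theorem traceNorm_nonneg (b : Matrix n n ℂ) : 0 ≤ traceNorm b :=
  (Complex.nonneg_iff.mp (Matrix.nonneg_iff_posSemidef.mp (CFC.sqrt_nonneg _)).trace_nonneg).1

/-! ### The Choi matrix -/

theorem choi_apply (φ : Matrix n n ℂ →ₗ[ℂ] Matrix n n ℂ) (i j k l : n) :
    choi φ (i, j) (k, l) = φ (Matrix.single i k 1) j l := by
  simp [choi, Matrix.sum_apply, Matrix.single_apply, Matrix.kroneckerMap_apply, ite_and]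

theorem map_eq_sum (φ : Matrix n n ℂ →ₗ[ℂ] Matrix m m ℂ) (a : Matrix n n ℂ) :
    φ a = ∑ i, ∑ j, a i j • φ (Matrix.single i j 1) := by
  conv_lhs => rw [Matrix.matrix_eq_sum_single a]
  simp only [map_sum]
  refine Finset.sum_congr rfl fun i _ => Finset.sum_congr rfl fun j _ => ?_
  rw [← map_smul, Matrix.smul_single, smul_eq_mul, mul_one]

/-- The transpose appears because Tr(Eᵢⱼ a) = aⱼᵢ; this is why the contractivity of transposition is
needed. -/
theorem trace_choi_mul_kronecker (φ : Matrix n n ℂ →ₗ[ℂ] Matrix n n ℂ) (a b : Matrix n n ℂ) :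
    (choi φ * (a ⊗ₖ b)).trace = (φ aᵀ * b).trace := by
  rw [map_eq_sum φ aᵀ, choi]
  simp only [Finset.sum_mul, Matrix.trace_sum, ← Matrix.mul_kronecker_mul,
    Matrix.trace_kronecker, Matrix.smul_mul, Matrix.trace_smul, smul_eq_mul,
    Matrix.transpose_apply]
  refine Finset.sum_congr rfl fun i _ => Finset.sum_congr rfl fun j _ => ?_
  simp [Matrix.trace_single_mul]

theorem exists_sum_kronecker (z : Matrix (n × n) (n × n) ℂ) :
    ∃ (k : ℕ) (a b : Fin k → Matrix n n ℂ), z = ∑ i, a i ⊗ₖ b i := by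
  let e := (Fintype.equivFin (n × n)).symm
  refine ⟨_, fun r => Matrix.single (e r).1 (e r).2 1,
    fun r => Matrix.of fun j l => z ((e r).1, j) ((e r).2, l), ?_⟩
  rw [Equiv.sum_comp e (fun p : n × n =>
    Matrix.single p.1 p.2 (1 : ℂ) ⊗ₖ (Matrix.of fun j l => z (p.1, j) (p.2, l))),
    Fintype.sum_prod_type]
  ext ⟨i, j⟩ ⟨k, l⟩
  simp [Matrix.sum_apply, Matrix.single_apply, Matrix.kroneckerMap_apply, ite_and]

theorem norm_apply_le {φ : Matrix n n ℂ →ₗ[ℂ] Matrix m m ℂ} (h : IsNormalized φ)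
    (a : Matrix n n ℂ) : ‖φ a‖ ≤ ‖a‖ := by
  have := (LinearMap.toContinuousLinearMap φ).le_opNorm a
  rwa [h, one_mul] at this

theorem isNormalized_of_norm_le [Nonempty n] {φ : Matrix n n ℂ →ₗ[ℂ] Matrix n n ℂ}
    (h1 : φ 1 = 1) (h : ∀ a, ‖φ a‖ ≤ ‖a‖) : IsNormalized φ := by
  apply le_antisymm
  · exact ContinuousLinearMap.opNorm_le_bound _ zero_le_one fun a => by simpa using h a
  · have := (LinearMap.toContinuousLinearMap φ).le_opNorm 1
    simpa [h1] using this

theorem norm_trace_choi_mul_le {φ : Matrix n n ℂ →ₗ[ℂ] Matrix n n ℂ}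
    (h : IsNormalized φ) (z : Matrix (n × n) (n × n) ℂ) :
    ‖(choi φ * z).trace‖ ≤ projectiveNorm z := by
  refine le_csInf ?_ ?_
  -- Without a decomposition of z the infimum would be the default value 0.
  · obtain ⟨k, a, b, hz⟩ := exists_sum_kronecker z
    exact ⟨_, k, a, b, hz, rfl⟩
  · rintro r ⟨k, a, b, rfl, rfl⟩
    rw [Finset.mul_sum, Matrix.trace_sum]
    refine (norm_sum_le _ _).trans (Finset.sum_le_sum fun i _ => ?_)
    rw [trace_choi_mul_kronecker]
    refine (norm_trace_mul_le _ _).trans ?_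
    exact mul_le_mul_of_nonneg_right ((norm_apply_le h _).trans (norm_transpose_le _))
      (traceNorm_nonneg _)

theorem alphaNorm_choi [Nonempty n] {φ : Matrix n n ℂ →ₗ[ℂ] Matrix n n ℂ}
    (h1 : φ 1 = 1) (h : IsNormalized φ) : alphaNorm (choi φ) = 1 := by
  -- A vanishing projective norm does no harm, since division by zero gives 0.
  have hle : ∀ z : Matrix (n × n) (n × n) ℂ,
      ‖(choi φ * z).trace‖ / projectiveNorm z ≤ 1 := fun z =>
    div_le_one_of_le₀ (norm_trace_choi_mul_le h z)
      ((norm_nonneg _).trans (norm_trace_choi_mul_le h z))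
  have hpos : (0 : ℝ) < Fintype.card n := by exact_mod_cast Fintype.card_pos
  have ht : ‖(choi φ * (1 : Matrix (n × n) (n × n) ℂ)).trace‖ = Fintype.card n := by
    rw [← Matrix.one_kronecker_one, trace_choi_mul_kronecker]
    simp [h1]
  have hp : projectiveNorm (1 : Matrix (n × n) (n × n) ℂ) = Fintype.card n := by
    apply le_antisymm
    · refine csInf_le ⟨0, ?_⟩ ⟨1, fun _ => 1, fun _ => 1, by simp, ?_⟩
      · rintro r ⟨k, a, b, -, rfl⟩
        exact Finset.sum_nonneg fun i _ => mul_nonneg (norm_nonneg _) (traceNorm_nonneg _)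
      · simp [traceNorm_of_posSemidef Matrix.PosSemidef.one]
    · rw [← ht]; exact norm_trace_choi_mul_le h 1
  apply le_antisymm
  · refine csSup_le ⟨_, 1, one_ne_zero, rfl⟩ ?_
    rintro r ⟨z, -, rfl⟩
    exact hle z
  · refine le_csSup ⟨1, ?_⟩ ⟨1, one_ne_zero, ?_⟩
    · rintro r ⟨z, -, rfl⟩
      exact hle z
    · rw [ht, hp, div_self hpos.ne']

theorem vecMulVec_single_add_single (i j : n) (c : ℂ) :
    Matrix.vecMulVec (Pi.single i 1 + Pi.single j c) (star (Pi.single i 1 + Pi.single j c)) =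
      Matrix.single i i (1 : ℂ) + c • Matrix.single j i (1 : ℂ) +
        star c • Matrix.single i j (1 : ℂ) + (c * star c) • Matrix.single j j (1 : ℂ) := by
  ext k l
  simp only [Matrix.vecMulVec_apply, Matrix.add_apply, Matrix.smul_apply, Matrix.single_apply,
    Pi.add_apply, Pi.star_apply, Pi.single_apply, smul_eq_mul, star_add, apply_ite star,
    star_one, star_zero]
  grind

/-- Polarization: images of the rank one matrices of eᵢ + c eⱼ are Hermitian, and c = 1 and c = I
together separate the two off-diagonal images. -/
theorem map_single_eq_conjTranspose {φ : Matrix n n ℂ →ₗ[ℂ] Matrix m m ℂ}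
    (h : IsPositiveMap φ) (i j : n) :
    φ (Matrix.single j i 1) = (φ (Matrix.single i j 1))ᴴ := by
  have key (c : ℂ) : (φ (Matrix.vecMulVec (Pi.single i 1 + Pi.single j c)
      (star (Pi.single i 1 + Pi.single j c))))ᴴ = φ (Matrix.vecMulVec
        (Pi.single i 1 + Pi.single j c) (star (Pi.single i 1 + Pi.single j c))) :=
    (h _ (Matrix.posSemidef_vecMulVec_self_star _)).1
  have hd (k : n) : (φ (Matrix.single k k 1))ᴴ = φ (Matrix.single k k 1) := by
    have := h _ (Matrix.posSemidef_vecMulVec_self_star (Pi.single k 1))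
    rw [show Matrix.vecMulVec (Pi.single k (1 : ℂ)) (star (Pi.single k 1)) =
      Matrix.single k k 1 by rw [Pi.star_single, star_one, Matrix.single_eq_single_vecMulVec_single]]
      at this
    exact this.1
  have k1 := key 1
  have k2 := key Complex.I
  simp only [vecMulVec_single_add_single, map_add, map_smul, Matrix.conjTranspose_add, Matrix.conjTranspose_smul, hd] at k1 k2
  ext p q
  have e1 := congr_fun₂ k1 p q
  have e2 := congr_fun₂ k2 p q
  simp at e1 e2 ⊢
  have e3 : Complex.I * (-(starRingEnd ℂ) (φ (Matrix.single j i 1) q p) +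
      (starRingEnd ℂ) (φ (Matrix.single i j 1) q p) - φ (Matrix.single j i 1) p q +
      φ (Matrix.single i j 1) p q) = 0 := by
    linear_combination e2
  have e4 := (mul_eq_zero.mp e3).resolve_left Complex.I_ne_zero
  linear_combination (-1 / 2 : ℂ) * e1 - (1 / 2 : ℂ) * e4

theorem choi_mem_setD [Nonempty n] {φ : Matrix n n ℂ →ₗ[ℂ] Matrix n n ℂ}
    (h : φ ∈ positiveMaps n) : choi φ ∈ setD n := by
  obtain ⟨hp, h1, hn⟩ := h
  refine ⟨?_, alphaNorm_choi h1 hn, fun x y => ?_, ?_⟩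
  · ext ⟨i, j⟩ ⟨k, l⟩
    rw [Matrix.conjTranspose_apply, choi_apply, choi_apply, map_single_eq_conjTranspose hp k i]
    simp
  -- The transpose of |x⟩⟨x| is |x̄⟩⟨x̄|, so the form at x ⊗ y equals ⟨y, φ(|x̄⟩⟨x̄|) y⟩.
  · have h2 := (hp _ (Matrix.posSemidef_vecMulVec_self_star (star x))).dotProduct_mulVec_nonneg y
    have h3 := trace_choi_mul_kronecker φ (Matrix.vecMulVec x (star x)) (Matrix.vecMulVec y (star y))
    have h4 : Matrix.vecMulVec x (star x) ⊗ₖ Matrix.vecMulVec y (star y) =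
        Matrix.vecMulVec (fun p : n × n => x p.1 * y p.2)
          (star fun p : n × n => x p.1 * y p.2) := by
      ext p q
      simp only [Matrix.kroneckerMap_apply, Matrix.vecMulVec_apply, Pi.star_apply, star_mul']
      ring
    rw [h4, Matrix.mul_vecMulVec, Matrix.mul_vecMulVec, Matrix.trace_vecMulVec,
      Matrix.trace_vecMulVec, dotProduct_comm, dotProduct_comm _ (star y),
      Matrix.transpose_vecMulVec] at h3
    rw [h3]
    simpa using h2
  · have := trace_choi_mul_kronecker φ 1 1
    rw [Matrix.one_kronecker_one, mul_one, Matrix.transpose_one, h1, mul_one] at this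
    rw [this, Matrix.trace_one]

/-! ### Convexity of the sets of maps -/

theorem unital_isNormalized_combination [Nonempty n] {φ ψ : Matrix n n ℂ →ₗ[ℂ] Matrix n n ℂ}
    (hφ : φ 1 = 1 ∧ IsNormalized φ) (hψ : ψ 1 = 1 ∧ IsNormalized ψ) {s t : ℝ} (hs : 0 ≤ s)
    (ht : 0 ≤ t) (hst : s + t = 1) :
    (s • φ + t • ψ) 1 = 1 ∧ IsNormalized (s • φ + t • ψ) := by
  have h1 : (s • φ + t • ψ) 1 = 1 := by
    simp only [LinearMap.add_apply, LinearMap.smul_apply, hφ.1, hψ.1, ← add_smul, hst, one_smul]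
  refine ⟨h1, isNormalized_of_norm_le h1 fun a => ?_⟩
  calc ‖(s • φ + t • ψ) a‖ ≤ ‖s • φ a‖ + ‖t • ψ a‖ := norm_add_le _ _
    _ ≤ s * ‖a‖ + t * ‖a‖ := by
      rw [norm_smul, norm_smul, Real.norm_of_nonneg hs, Real.norm_of_nonneg ht]
      gcongr
      exacts [norm_apply_le hφ.2 a, norm_apply_le hψ.2 a]
    _ = ‖a‖ := by rw [← add_mul, hst, one_mul]

theorem convex_positiveMaps [Nonempty n] : Convex ℝ (positiveMaps n) :=
  fun _ hφ _ hψ _ _ hs ht hst =>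
    ⟨fun a ha => ((hφ.1 a ha).smul hs).add ((hψ.1 a ha).smul ht),
      unital_isNormalized_combination hφ.2 hψ.2 hs ht hst⟩

theorem convex_completelyPositiveMaps [Nonempty n] : Convex ℝ (completelyPositiveMaps n) :=
  fun _ hφ _ hψ _ _ hs ht hst =>
    ⟨fun k A hA => ((hφ.1 k A hA).smul hs).add ((hψ.1 k A hA).smul ht),
      unital_isNormalized_combination hφ.2 hψ.2 hs ht hst⟩

theorem IsCompletelyPositive.isPositiveMap {φ : Matrix n n ℂ →ₗ[ℂ] Matrix m m ℂ}
    (h : IsCompletelyPositive φ) : IsPositiveMap φ := fun a ha => by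
  have h1 := h 1 (Matrix.of fun _ _ => a) (ha.submatrix Prod.snd)
  exact h1.submatrix fun i => (0, i)

/-- A point extreme in `S` stays extreme in the smaller convex hull of `A`, whose extreme points lie
in `A`. This turns a convex decomposition of an extreme map into an identification of the map. -/
theorem mem_of_mem_extremePoints {E : Type*} [AddCommGroup E] [Module ℝ E] {S A : Set E}
    (hS : Convex ℝ S) (hA : A ⊆ S) {x : E} (hx : x ∈ S.extremePoints ℝ)
    (hxA : x ∈ convexHull ℝ A) : x ∈ A :=
  extremePoints_convexHull_subset
    (inter_extremePoints_subset_extremePoints_of_subset (convexHull_min hA hS) ⟨hxA, hx⟩)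

/-! ### Unitary conjugations -/

/-- The map `a ↦ v a v*`. -/
noncomputable def conjMap (v : Matrix n n ℂ) : Matrix n n ℂ →ₗ[ℂ] Matrix n n ℂ :=
  LinearMap.mulLeftRight ℂ (v, vᴴ)

/-- The map `a ↦ v aᵀ v*`. -/
noncomputable def conjTransposeMap (v : Matrix n n ℂ) : Matrix n n ℂ →ₗ[ℂ] Matrix n n ℂ :=
  conjMap v ∘ₗ (Matrix.transposeLinearEquiv n n ℂ ℂ).toLinearMap

theorem conjMap_apply (v a : Matrix n n ℂ) : conjMap v a = v * a * vᴴ := rfl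

theorem conjTransposeMap_apply (v a : Matrix n n ℂ) : conjTransposeMap v a = v * aᵀ * vᴴ := rfl

theorem isCompletelyPositive_conjMap (v : Matrix n n ℂ) : IsCompletelyPositive (conjMap v) := by
  intro k A hA
  -- Entrywise conjugation by v is conjugation of the whole block matrix by 1 ⊗ v.
  convert hA.mul_mul_conjTranspose_same ((1 : Matrix (Fin k) (Fin k) ℂ) ⊗ₖ v) using 1
  ext ⟨i, p⟩ ⟨j, q⟩
  simp [conjMap_apply, Matrix.mul_apply, Fintype.sum_prod_type, Matrix.one_apply,
    Matrix.kroneckerMap_apply, apply_ite (starRingEnd ℂ)]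

theorem norm_le_one_of_mem_unitary [Nonempty n] {v : Matrix n n ℂ} (hv : v * vᴴ = 1) :
    ‖v‖ ≤ 1 := by
  have := CStarRing.norm_self_mul_star (x := v)
  rw [Matrix.star_eq_conjTranspose, hv, norm_one] at this
  nlinarith [norm_nonneg v]

theorem norm_conjMap_le [Nonempty n] {v : Matrix n n ℂ} (hv : v * vᴴ = 1) (a : Matrix n n ℂ) :
    ‖conjMap v a‖ ≤ ‖a‖ := by
  have h1 := norm_le_one_of_mem_unitary hv
  have h2 : ‖vᴴ‖ ≤ 1 := by rwa [Matrix.l2_opNorm_conjTranspose]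
  calc ‖v * a * vᴴ‖ ≤ ‖v‖ * ‖a‖ * ‖vᴴ‖ := (norm_mul_le _ _).trans (by gcongr; exact norm_mul_le _ _)
    _ ≤ 1 * ‖a‖ * 1 := by gcongr
    _ = ‖a‖ := by ring

theorem conjMap_mem_completelyPositiveMaps [Nonempty n] {v : Matrix n n ℂ} (hv : v * vᴴ = 1) :
    conjMap v ∈ completelyPositiveMaps n := by
  have h1 : conjMap v 1 = 1 := by rw [conjMap_apply, mul_one, hv]
  exact ⟨isCompletelyPositive_conjMap v, h1, isNormalized_of_norm_le h1 (norm_conjMap_le hv)⟩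

theorem conjMap_mem_positiveMaps [Nonempty n] {v : Matrix n n ℂ} (hv : v * vᴴ = 1) :
    conjMap v ∈ positiveMaps n :=
  have h := conjMap_mem_completelyPositiveMaps hv
  ⟨h.1.isPositiveMap, h.2⟩

theorem conjTransposeMap_mem_positiveMaps [Nonempty n] {v : Matrix n n ℂ} (hv : v * vᴴ = 1) :
    conjTransposeMap v ∈ positiveMaps n := by
  have h1 : conjTransposeMap v 1 = 1 := by
    rw [conjTransposeMap_apply, Matrix.transpose_one, mul_one, hv]
  refine ⟨fun a ha => ?_, h1, isNormalized_of_norm_le h1 fun a => ?_⟩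
  · exact ha.transpose.mul_mul_conjTranspose_same v
  · exact (norm_conjMap_le hv _).trans (norm_transpose_le a)

theorem choi_conjMap (v : Matrix n n ℂ) :
    choi (conjMap v) = ketBra fun p : n × n => v p.2 p.1 := by
  ext ⟨i, j⟩ ⟨k, l⟩
  simp [choi_apply, conjMap_apply, ketBra, Matrix.vecMulVec_apply, Matrix.mul_apply,
    Matrix.single_apply, ite_and]

/-- For v = 1 the Choi matrix is the swap. In general the double sum in its square factors into an
entry of v v* times an entry of v* v. -/
theorem choi_conjTransposeMap_mul_self {v : Matrix n n ℂ} (hv : v * vᴴ = 1) :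
    choi (conjTransposeMap v) * choi (conjTransposeMap v) = 1 := by
  have hv' : vᴴ * v = 1 := mul_eq_one_comm.mp hv
  have he (i j k l : n) : choi (conjTransposeMap v) (i, j) (k, l) = v j k * star (v l i) := by
    simp [choi_apply, conjTransposeMap_apply, Matrix.mul_apply, Matrix.single_apply, ite_and]
  ext ⟨i, j⟩ ⟨k, l⟩
  have h1 := congr_fun₂ hv j l
  have h2 := congr_fun₂ hv' i k
  simp only [Matrix.mul_apply, Matrix.conjTranspose_apply] at h1 h2
  simp only [Matrix.mul_apply, Fintype.sum_prod_type, he]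
  calc ∑ x, ∑ y, v j x * star (v y i) * (v y k * star (v l x))
      = (∑ x, v j x * star (v l x)) * ∑ y, star (v y i) * v y k := by
        rw [Finset.sum_mul_sum]
        exact Finset.sum_congr rfl fun x _ => Finset.sum_congr rfl fun y _ => by ring
    _ = _ := by
        rw [h1, h2]
        simp only [Matrix.one_apply, Prod.mk.injEq, ite_and]
        split_ifs <;> simp

/-- An orthonormal basis forming the columns of a unitary matrix. -/
theorem exists_orthonormalBasis_of_unitary {v : Matrix n n ℂ} (hv : v * vᴴ = 1) :
    ∃ f : OrthonormalBasis n ℂ (EuclideanSpace ℂ n), ∀ i j, f j i = v i j := by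
  have hv' : vᴴ * v = 1 := mul_eq_one_comm.mp hv
  let f : n → EuclideanSpace ℂ n := fun j => WithLp.toLp 2 fun i => v i j
  have hf : Orthonormal ℂ f := by
    rw [orthonormal_iff_ite]
    intro i j
    have := congr_fun₂ hv' i j
    rw [EuclideanSpace.inner_eq_star_dotProduct, dotProduct_comm]
    simpa [Matrix.mul_apply, Matrix.one_apply, dotProduct, f] using this
  have hs : ⊤ ≤ Submodule.span ℂ (Set.range f) := by
    rw [hf.linearIndependent.span_eq_top_of_card_eq_finrank' (by simp)]
  exact ⟨OrthonormalBasis.mk hf hs, fun i j => by rw [OrthonormalBasis.coe_mk hf hs]⟩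

theorem orthonormalBasis_unitary (f : OrthonormalBasis n ℂ (EuclideanSpace ℂ n)) :
    (Matrix.of fun i j => f j i) * (Matrix.of fun i j => f j i)ᴴ = (1 : Matrix n n ℂ) := by
  rw [mul_eq_one_comm]
  ext i j
  have := orthonormal_iff_ite.mp f.orthonormal i j
  rw [EuclideanSpace.inner_eq_star_dotProduct, dotProduct_comm] at this
  simpa [Matrix.mul_apply, Matrix.one_apply, dotProduct] using this

/-! ### Members of `𝔇` -/

theorem ketBra_smul {ι : Type} (c : ℂ) (x : ι → ℂ) :
    ketBra (c • x) = (c * star c) • ketBra x := by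
  ext i j
  simp [ketBra, Matrix.vecMulVec_apply]
  ring

theorem card_mul_inv_sqrt_card [Nonempty n] :
    (Fintype.card n : ℂ) * (((√(Fintype.card n : ℝ) : ℝ) : ℂ)⁻¹ *
      star ((√(Fintype.card n : ℝ) : ℝ) : ℂ)⁻¹) = 1 := by
  have h1 : ((√(Fintype.card n : ℝ) : ℝ) : ℂ) * ((√(Fintype.card n : ℝ) : ℝ) : ℂ) =
      (Fintype.card n : ℂ) := by
    rw [← Complex.ofReal_mul, Real.mul_self_sqrt (Nat.cast_nonneg _)]; simp
  have h2 : (Fintype.card n : ℂ) ≠ 0 := by simp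
  rw [star_inv₀, Complex.star_def, Complex.conj_ofReal, ← mul_inv, h1, mul_inv_cancel₀ h2]

/-- With U, V the unitaries of the two bases, √n x is the vectorization of V Uᵀ, so n P_x is the
Choi matrix of conjugation by V Uᵀ. -/
theorem smul_ketBra_mem_setD [Nonempty n] {x : n × n → ℂ} (hx : IsMaximallyEntangled x) :
    (Fintype.card n : ℂ) • ketBra x ∈ setD n := by
  obtain ⟨u, v, hx⟩ := hx
  set U : Matrix n n ℂ := Matrix.of fun i j => u j i with hUdef
  set V : Matrix n n ℂ := Matrix.of fun i j => v j i with hVdef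
  have hU : U * Uᴴ = 1 := orthonormalBasis_unitary u
  have hV : V * Vᴴ = 1 := orthonormalBasis_unitary v
  have hU' : Uᵀ * Uᵀᴴ = 1 := by
    have := congrArg Matrix.transpose (mul_eq_one_comm.mp hU)
    rwa [Matrix.transpose_mul, Matrix.transpose_one] at this
  have hW : (V * Uᵀ) * (V * Uᵀ)ᴴ = 1 := by
    rw [Matrix.conjTranspose_mul, mul_assoc, ← mul_assoc Uᵀ, hU', one_mul, hV]
  have hx' : x = ((√(Fintype.card n : ℝ) : ℝ) : ℂ)⁻¹ • fun p : n × n => (V * Uᵀ) p.2 p.1 := by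
    ext p
    simp [hx, Matrix.mul_apply, hUdef, hVdef, mul_comm]
  rw [hx', ketBra_smul, smul_smul, card_mul_inv_sqrt_card, one_smul, ← choi_conjMap]
  exact choi_mem_setD (conjMap_mem_positiveMaps hW)

theorem eigenvalues_eq_zero_or_one {p : Matrix n n ℂ} (hp : p.IsHermitian) (hpp : p * p = p)
    (i : n) : hp.eigenvalues i = 0 ∨ hp.eigenvalues i = 1 := by
  have h := hp.mulVec_eigenvectorBasis i
  have h2 : p *ᵥ (p *ᵥ (hp.eigenvectorBasis i).ofLp) = p *ᵥ (hp.eigenvectorBasis i).ofLp := by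
    rw [Matrix.mulVec_mulVec, hpp]
  rw [h, Matrix.mulVec_smul, h, smul_smul, ← sub_eq_zero, ← sub_smul, smul_eq_zero] at h2
  rcases h2 with h2 | h2
  · have : hp.eigenvalues i * (hp.eigenvalues i - 1) = 0 := by linear_combination h2
    exact (mul_eq_zero.mp this).imp id sub_eq_zero.mp
  · have := hp.eigenvectorBasis.norm_eq_one i
    rw [show hp.eigenvectorBasis i = 0 from WithLp.ofLp_injective 2 h2] at this
    simp at this

theorem IsRankOneProjector.trace_eq_one {p : Matrix n n ℂ} (hp : IsRankOneProjector p) :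
    p.trace = 1 := by
  obtain ⟨h, hpp, hr⟩ := hp
  rw [h.rank_eq_card_non_zero_eigs, Fintype.card_subtype, Finset.card_eq_sum_ones] at hr
  rw [h.trace_eq_sum_eigenvalues]
  have h1 : ∀ i, (h.eigenvalues i : ℂ) = if h.eigenvalues i ≠ 0 then ((1 : ℕ) : ℂ) else 0 := by
    intro i
    rcases eigenvalues_eq_zero_or_one h hpp i with h0 | h0 <;> simp [h0]
  calc ∑ i, (h.eigenvalues i : ℂ) = ∑ i, if h.eigenvalues i ≠ 0 then ((1 : ℕ) : ℂ) else 0 :=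
        Finset.sum_congr rfl fun i _ => h1 i
    _ = 1 := by rw [← Finset.sum_filter, ← Nat.cast_sum, hr, Nat.cast_one]

/-- The matrix p ⊗ 1 is the Choi matrix of a ↦ Tr(a pᵀ) 1, which is contractive because pᵀ has trace
norm 1. -/
theorem kronecker_one_mem_setD [Nonempty n] {p : Matrix n n ℂ} (hp : IsRankOneProjector p) :
    p ⊗ₖ (1 : Matrix n n ℂ) ∈ setD n := by
  have htr := hp.trace_eq_one
  have hpsd : p.PosSemidef := by
    have := Matrix.posSemidef_conjTranspose_mul_self p
    rwa [hp.1.eq, hp.2.1] at this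
  have hpt := hpsd.transpose
  let φ : Matrix n n ℂ →ₗ[ℂ] Matrix n n ℂ :=
    (Matrix.traceLinearMap n ℂ ℂ ∘ₗ LinearMap.mulRight ℂ pᵀ).smulRight 1
  have hφ (a) : φ a = (a * pᵀ).trace • 1 := rfl
  have h1 : φ 1 = 1 := by rw [hφ, one_mul, Matrix.trace_transpose, htr, one_smul]
  have hmem : φ ∈ positiveMaps n := by
    refine ⟨fun a ha => ?_, h1, isNormalized_of_norm_le h1 fun a => ?_⟩
    · rw [hφ]
      refine Matrix.PosSemidef.one.smul ?_
      have h2 := (ha.mul_mul_conjTranspose_same pᵀ).trace_nonneg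
      rw [hpt.1.eq, mul_assoc, Matrix.trace_mul_comm, mul_assoc, ← Matrix.transpose_mul,
        hp.2.1] at h2
      exact h2
    · rw [hφ, norm_smul, norm_one, mul_one]
      refine (norm_trace_mul_le _ _).trans (le_of_eq ?_)
      rw [traceNorm_of_posSemidef hpt, Matrix.trace_transpose, htr, Complex.one_re, mul_one]
  convert choi_mem_setD hmem using 1
  ext ⟨i, j⟩ ⟨k, l⟩
  rw [choi_apply, hφ, Matrix.trace_single_mul]
  simp [Matrix.kroneckerMap_apply]

theorem mul_diagonal_unitary {v : Matrix (Fin 2) (Fin 2) ℂ} (hv : v * vᴴ = 1) {β γ : ℂ}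
    (hβ : β * star β = 1) (hγ : γ * star γ = 1) :
    (v * Matrix.diagonal ![β, γ]) * (v * Matrix.diagonal ![β, γ])ᴴ = 1 := by
  have : Matrix.diagonal ![β, γ] * (Matrix.diagonal ![β, γ])ᴴ = 1 := by
    rw [Matrix.diagonal_conjTranspose, Matrix.diagonal_mul_diagonal]
    ext i j
    fin_cases i <;> fin_cases j <;> simp
    exacts [hβ, hγ]
  rw [Matrix.conjTranspose_mul, mul_assoc, ← mul_assoc (Matrix.diagonal _), this, one_mul, hv]

/-- Averaging the conjugations by V and V diag(1, -1) cancels the off-diagonal blocks and keeps the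
diagonal ones. -/
theorem diagonalChoi_mem_setD (y : OrthonormalBasis (Fin 2) ℂ (EuclideanSpace ℂ (Fin 2))) :
    diagonalChoi y ∈ setD (Fin 2) := by
  set V : Matrix (Fin 2) (Fin 2) ℂ := Matrix.of fun i j => y j i with hVdef
  have hV : V * Vᴴ = 1 := orthonormalBasis_unitary y
  have hW : (V * Matrix.diagonal ![1, -1]) * (V * Matrix.diagonal ![1, -1])ᴴ = 1 :=
    mul_diagonal_unitary hV (by simp) (by simp)
  have hmem := convex_positiveMaps (conjMap_mem_positiveMaps hV) (conjMap_mem_positiveMaps hW)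
    (by norm_num : (0 : ℝ) ≤ 1 / 2) (by norm_num : (0 : ℝ) ≤ 1 / 2) (by norm_num)
  convert choi_mem_setD hmem using 1
  ext ⟨i, j⟩ ⟨k, l⟩
  rw [choi_apply]
  simp only [diagonalChoi, ketBra, LinearMap.add_apply, LinearMap.smul_apply, conjMap_apply,
    Matrix.add_apply, Matrix.smul_apply, Matrix.sum_apply, Matrix.kroneckerMap_apply,
    Matrix.vecMulVec_apply]
  fin_cases i <;> fin_cases k <;>
    simp [Matrix.mul_apply, Matrix.single_apply, Fin.sum_univ_two, hVdef, Matrix.diagonal_apply]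
      <;> ring

theorem union_subset_setD :
    setDTilde (Fin 2) ∪ Set.range (diagonalChoi (n := Fin 2)) ⊆ setD (Fin 2) := by
  rintro ρ (((h | ⟨x, hx, rfl⟩) | ⟨p, hp, rfl⟩) | ⟨y, rfl⟩)
  exacts [h.1, smul_ketBra_mem_setD hx, kronecker_one_mem_setD hp, diagonalChoi_mem_setD y]

theorem choi_conjMap_mem_setDTilde [Nonempty n] {v : Matrix n n ℂ} (hv : v * vᴴ = 1) :
    choi (conjMap v) ∈ setDTilde n := by
  obtain ⟨f, hf⟩ := exists_orthonormalBasis_of_unitary hv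
  refine Or.inl (Or.inr ⟨fun p => ((√(Fintype.card n : ℝ) : ℝ) : ℂ)⁻¹ * v p.2 p.1,
    ⟨EuclideanSpace.basisFun n ℂ, f, fun p => ?_⟩, ?_⟩)
  · simp [hf]
  · have := ketBra_smul ((√(Fintype.card n : ℝ) : ℝ) : ℂ)⁻¹ fun p : n × n => v p.2 p.1
    rw [choi_conjMap, show (fun p : n × n => ((√(Fintype.card n : ℝ) : ℝ) : ℂ)⁻¹ * v p.2 p.1) =
      ((√(Fintype.card n : ℝ) : ℝ) : ℂ)⁻¹ • (fun p : n × n => v p.2 p.1) from rfl, this,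
      smul_smul, card_mul_inv_sqrt_card, one_smul]

theorem choi_conjTransposeMap_mem_setDTilde [Nonempty n] {v : Matrix n n ℂ} (hv : v * vᴴ = 1) :
    choi (conjTransposeMap v) ∈ setDTilde n := by
  have h := choi_mem_setD (conjTransposeMap_mem_positiveMaps hv)
  exact Or.inl (Or.inl ⟨h, h.1, choi_conjTransposeMap_mul_self hv⟩)

/-! ### Extreme maps on the diagonal algebra -/

/-- The map `diag(d₀, d₁) ↦ d₀ A + d₁ (1 - A)`. -/
noncomputable def diagonalMap (A : Matrix (Fin 2) (Fin 2) ℂ) :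
    diagonalAlgebra (Fin 2) →ₗ[ℂ] Matrix (Fin 2) (Fin 2) ℂ :=
  ((Matrix.entryLinearMap ℂ ℂ 0 0).smulRight A + (Matrix.entryLinearMap ℂ ℂ 1 1).smulRight (1 - A))
    ∘ₗ (diagonalAlgebra (Fin 2)).val.toLinearMap

theorem diagonalMap_apply (A : Matrix (Fin 2) (Fin 2) ℂ) (d : diagonalAlgebra (Fin 2)) :
    diagonalMap A d = (d : Matrix (Fin 2) (Fin 2) ℂ) 0 0 • A +
      (d : Matrix (Fin 2) (Fin 2) ℂ) 1 1 • (1 - A) := rfl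

theorem diagonalMap_mem {A : Matrix (Fin 2) (Fin 2) ℂ} (hA : A.PosSemidef)
    (hA' : (1 - A).PosSemidef) : diagonalMap A ∈ diagonalMaps (Fin 2) := by
  refine ⟨fun k X hX => ?_, by simp [diagonalMap_apply]⟩
  -- The amplified image is X₀₀ ⊗ A + X₁₁ ⊗ (1 - A), where Xᵢᵢ collects the (i, i) entries of the
  -- blocks.
  have h := ((hX.submatrix fun i : Fin k => (i, (0 : Fin 2))).kronecker hA).add
    ((hX.submatrix fun i : Fin k => (i, (1 : Fin 2))).kronecker hA')
  refine (congrArg Matrix.PosSemidef ?_).mp h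
  ext ⟨i, p⟩ ⟨j, q⟩
  simp [diagonalMap_apply, Matrix.kroneckerMap_apply]

theorem single_mem_diagonalAlgebra (i : n) : Matrix.single i i (1 : ℂ) ∈ diagonalAlgebra n :=
  ⟨Pi.single i 1, Matrix.diagonal_single i 1⟩

theorem comp_val_eq_diagonalMap {φ : Matrix (Fin 2) (Fin 2) ℂ →ₗ[ℂ] Matrix (Fin 2) (Fin 2) ℂ}
    (h : φ (Matrix.single 1 1 1) = 1 - φ (Matrix.single 0 0 1)) :
    φ ∘ₗ (diagonalAlgebra (Fin 2)).val.toLinearMap = diagonalMap (φ (Matrix.single 0 0 1)) := by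
  ext1 ⟨a, d, rfl⟩
  rw [diagonalMap_apply, ← h]
  change φ (Matrix.diagonal d) = Matrix.diagonal d 0 0 • _ + Matrix.diagonal d 1 1 • _
  rw [map_eq_sum]
  simp [Fin.sum_univ_two]

/-- Both A² and 2A - A² lie between 0 and 1, so they define admissible maps with midpoint
`diagonalMap A`; extremality gives A² = A. -/
theorem isIdempotentElem_of_diagonalMap_mem_extremePoints {A : Matrix (Fin 2) (Fin 2) ℂ}
    (hA : A.PosSemidef) (hA' : (1 - A).PosSemidef)
    (h : diagonalMap A ∈ (diagonalMaps (Fin 2)).extremePoints ℝ) : A * A = A := by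
  have h0 : (A * A).PosSemidef := by
    have := Matrix.posSemidef_conjTranspose_mul_self A
    rwa [hA.1.eq] at this
  have h0' : (1 - (A + A - A * A)).PosSemidef := by
    have := Matrix.posSemidef_conjTranspose_mul_self (1 - A)
    rw [hA'.1.eq] at this
    convert this using 1
    noncomm_ring
  -- Uses A - A² = A(1 - A)A + (1 - A)A(1 - A).
  have h1 : (A - A * A).PosSemidef := by
    have h2 := hA'.mul_mul_conjTranspose_same A
    have h3 := hA.mul_mul_conjTranspose_same (1 - A)
    rw [hA.1.eq] at h2
    rw [hA'.1.eq] at h3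
    convert h2.add h3 using 1
    noncomm_ring
  have m1 := diagonalMap_mem h0 (by convert hA'.add h1 using 1; abel)
  have m2 := diagonalMap_mem (by convert hA.add h1 using 1; abel) h0'
  have := (mem_extremePoints.mp h).2 _ m1 _ m2
    ⟨1 / 2, 1 / 2, by norm_num, by norm_num, by norm_num, by
      ext1 d
      ext i j
      simp [diagonalMap_apply]
      ring⟩
  have e := LinearMap.congr_fun this.1 ⟨_, single_mem_diagonalAlgebra 0⟩
  simpa [diagonalMap_apply] using e

/-- A projector of `M_2` is unitarily equivalent to `0`, `1` or `E₀₀`. -/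
theorem exists_unitary_of_isIdempotentElem {A : Matrix (Fin 2) (Fin 2) ℂ} (hA : A.IsHermitian)
    (h : A * A = A) : A = 0 ∨ A = 1 ∨
      ∃ v : Matrix (Fin 2) (Fin 2) ℂ, v * vᴴ = 1 ∧ A = v * Matrix.single 0 0 1 * vᴴ := by
  let U : Matrix (Fin 2) (Fin 2) ℂ := hA.eigenvectorUnitary.1
  have hUU : U * Uᴴ = 1 := Matrix.mem_unitaryGroup_iff.mp hA.eigenvectorUnitary.2
  have hs : A = U * Matrix.diagonal (RCLike.ofReal ∘ hA.eigenvalues) * Uᴴ := by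
    conv_lhs => rw [hA.spectral_theorem, Unitary.conjStarAlgAut_apply]
    rfl
  rcases eigenvalues_eq_zero_or_one hA h 0 with h0 | h0 <;>
    rcases eigenvalues_eq_zero_or_one hA h 1 with h1 | h1
  · left
    rw [hs, show Matrix.diagonal (RCLike.ofReal ∘ hA.eigenvalues) = (0 : Matrix _ _ ℂ) by
      ext i j; fin_cases i <;> fin_cases j <;> simp [h0, h1]]
    simp
  · right; right
    refine ⟨U * !![0, 1; 1, 0], ?_, ?_⟩
    · rw [Matrix.conjTranspose_mul, mul_assoc, ← mul_assoc !![_, _; _, _],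
        show !![0, 1; 1, 0] * !![0, 1; 1, (0 : ℂ)]ᴴ = 1 by
          ext i j; fin_cases i <;> fin_cases j <;> simp [Matrix.mul_apply], one_mul, hUU]
    · conv_lhs => rw [hs]
      rw [Matrix.conjTranspose_mul, show Matrix.diagonal (RCLike.ofReal ∘ hA.eigenvalues) =
        !![0, 1; 1, 0] * Matrix.single 0 0 1 * !![0, 1; 1, (0 : ℂ)]ᴴ by
          ext i j
          fin_cases i <;> fin_cases j <;> simp [h0, h1, Matrix.vecMul, dotProduct]]
      simp only [mul_assoc]
  · right; right
    refine ⟨U, hUU, ?_⟩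
    conv_lhs => rw [hs]
    rw [show Matrix.diagonal (RCLike.ofReal ∘ hA.eigenvalues) = Matrix.single 0 0 (1 : ℂ) by
      ext i j; fin_cases i <;> fin_cases j <;> simp [h0, h1]]
  · right; left
    rw [hs, show Matrix.diagonal (RCLike.ofReal ∘ hA.eigenvalues) = (1 : Matrix _ _ ℂ) by
      ext i j; fin_cases i <;> fin_cases j <;> simp [h0, h1]]
    rw [mul_one, hUU]

/-! ### Off-diagonal blocks of positive maps -/

/-- With q the number to be shown zero, testing positivity on eᵢ - t q eⱼ leaves a real expression
with slope -2|q|² in t. It stays nonnegative for every real t only if q = 0. -/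
theorem dotProduct_map_single_eq_zero {φ : Matrix n n ℂ →ₗ[ℂ] Matrix m m ℂ}
    (h : IsPositiveMap φ) (i j : n) (y : m → ℂ)
    (hy : star y ⬝ᵥ (φ (Matrix.single j j 1) *ᵥ y) = 0) :
    star y ⬝ᵥ (φ (Matrix.single i j 1) *ᵥ y) = 0 := by
  set q := star y ⬝ᵥ (φ (Matrix.single i j 1) *ᵥ y) with hq
  have hq' : star y ⬝ᵥ (φ (Matrix.single j i 1) *ᵥ y) = star q := by
    rw [map_single_eq_conjTranspose h, hq, Matrix.star_dotProduct, Matrix.star_mulVec,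
      Matrix.conjTranspose_conjTranspose, ← Matrix.dotProduct_mulVec]
  have key (t : ℝ) : 0 ≤ (star y ⬝ᵥ (φ (Matrix.single i i 1) *ᵥ y)).re -
      2 * t * Complex.normSq q := by
    have h1 := (h _ (Matrix.posSemidef_vecMulVec_self_star
      (Pi.single i 1 + Pi.single j (-(t : ℂ) * q)))).dotProduct_mulVec_nonneg y
    rw [vecMulVec_single_add_single] at h1
    simp only [map_add, map_smul, Matrix.add_mulVec, Matrix.smul_mulVec, dotProduct_add,
      dotProduct_smul, hy, hq', ← hq] at h1
    have h2 := (Complex.nonneg_iff.mp h1).1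
    simp [Complex.normSq_apply] at h2 ⊢
    linarith
  by_contra hne
  have hpos : 0 < Complex.normSq q := Complex.normSq_pos.mpr hne
  -- This t makes the expression equal to -1.
  have := key (((star y ⬝ᵥ (φ (Matrix.single i i 1) *ᵥ y)).re + 1) / (2 * Complex.normSq q))
  rw [show 2 * (((star y ⬝ᵥ (φ (Matrix.single i i 1) *ᵥ y)).re + 1) / (2 * Complex.normSq q)) *
    Complex.normSq q = (star y ⬝ᵥ (φ (Matrix.single i i 1) *ᵥ y)).re + 1 by field_simp] at this
  linarith

theorem eq_zero_of_forall_dotProduct_mulVec_eq_zero {B : Matrix n n ℂ}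
    (h : ∀ y : n → ℂ, star y ⬝ᵥ (B *ᵥ y) = 0) : B = 0 := by
  have h1 : Matrix.toEuclideanLin B = 0 := by
    rw [← inner_map_self_eq_zero]
    intro x
    have := congrArg star (h x.ofLp)
    rw [Matrix.star_dotProduct, star_star, star_zero] at this
    rw [EuclideanSpace.inner_eq_star_dotProduct, dotProduct_comm]
    exact this
  exact (map_eq_zero_iff _ (LinearEquiv.injective _)).mp h1

theorem choi_eq_kronecker_one {φ : Matrix (Fin 2) (Fin 2) ℂ →ₗ[ℂ] Matrix (Fin 2) (Fin 2) ℂ}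
    (h : IsPositiveMap φ) {i j : Fin 2} (hij : i ≠ j) (hi : φ (Matrix.single i i 1) = 1)
    (hj : φ (Matrix.single j j 1) = 0) : choi φ = Matrix.single i i 1 ⊗ₖ 1 := by
  have h1 : φ (Matrix.single i j 1) = 0 :=
    eq_zero_of_forall_dotProduct_mulVec_eq_zero fun y =>
      dotProduct_map_single_eq_zero h i j y (by simp [hj])
  have h2 : φ (Matrix.single j i 1) = 0 := by
    rw [map_single_eq_conjTranspose h, h1, Matrix.conjTranspose_zero]
  ext ⟨a, b⟩ ⟨c, d⟩
  rw [choi_apply, Matrix.kroneckerMap_apply, Matrix.single_apply]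
  fin_cases i <;> fin_cases j <;> simp at hij <;> fin_cases a <;> fin_cases c <;>
    simp at hi hj h1 h2 <;> simp [hi, hj, h1, h2]

theorem isRankOneProjector_single (i : n) : IsRankOneProjector (Matrix.single i i (1 : ℂ)) := by
  refine ⟨by simp [Matrix.IsHermitian], by simp, ?_⟩
  rw [← Matrix.diagonal_single, Matrix.rank_diagonal, Fintype.card_eq_one_iff]
  refine ⟨⟨i, by simp⟩, fun ⟨j, hj⟩ => ?_⟩
  by_contra hne
  exact hj (Pi.single_eq_of_ne (fun h => hne (Subtype.ext h)) _)

/-! ### Maps fixing the diagonal matrix units -/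

theorem exists_norm_eq_one_mul_norm (b : ℂ) : ∃ β : ℂ, β * star β = 1 ∧ b = ‖b‖ * β := by
  refine ⟨Complex.exp (b.arg * Complex.I), ?_, (Complex.norm_mul_exp_arg_mul_I b).symm⟩
  rw [Complex.star_def, Complex.mul_conj, Complex.normSq_eq_norm_sq,
    Complex.norm_exp_ofReal_mul_I]
  simp

/-- Rotating b and c by opposite angles, each half the difference of the arguments, aligns both with
the mean argument. -/
theorem exists_norm_add_eq (b c : ℂ) :
    ∃ z : ℂ, z * star z = 1 ∧ ‖z * b + star z * c‖ = ‖b‖ + ‖c‖ := by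
  set θ : ℝ := (c.arg - b.arg) / 2 with hθ
  have hs : star (Complex.exp (θ * Complex.I)) = Complex.exp (-(θ * Complex.I)) := by
    rw [Complex.star_def, ← Complex.exp_conj]; simp
  refine ⟨Complex.exp (θ * Complex.I), ?_, ?_⟩
  · rw [hs, ← Complex.exp_add, add_neg_cancel, Complex.exp_zero]
  · have h1 : Complex.exp (θ * Complex.I) * b + star (Complex.exp (θ * Complex.I)) * c =
        ((‖b‖ + ‖c‖ : ℝ) : ℂ) * Complex.exp (((b.arg + c.arg) / 2 : ℝ) * Complex.I) := by
      rw [hs]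
      conv_lhs => rw [← Complex.norm_mul_exp_arg_mul_I b, ← Complex.norm_mul_exp_arg_mul_I c,
        mul_left_comm, ← Complex.exp_add, mul_left_comm, ← Complex.exp_add]
      rw [show (θ : ℂ) * Complex.I + b.arg * Complex.I =
          (((b.arg + c.arg) / 2 : ℝ) : ℂ) * Complex.I by rw [hθ]; push_cast; ring,
        show -((θ : ℂ) * Complex.I) + c.arg * Complex.I =
          (((b.arg + c.arg) / 2 : ℝ) : ℂ) * Complex.I by rw [hθ]; push_cast; ring]
      push_cast
      ring
    rw [h1, norm_mul, Complex.norm_exp_ofReal_mul_I, mul_one, Complex.norm_real,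
      Real.norm_of_nonneg (by positivity)]

/-- A positive map fixing `E₀₀` and `E₁₁` maps `E₀₁` to a combination `b E₀₁ + c E₁₀`. -/
theorem exists_map_single_eq {ψ : Matrix (Fin 2) (Fin 2) ℂ →ₗ[ℂ] Matrix (Fin 2) (Fin 2) ℂ}
    (h : IsPositiveMap ψ) (h0 : ψ (Matrix.single 0 0 1) = Matrix.single 0 0 1)
    (h1 : ψ (Matrix.single 1 1 1) = Matrix.single 1 1 1) :
    ∃ b c : ℂ, ψ (Matrix.single 0 1 1) = !![0, b; c, 0] ∧
      ∀ a, ψ a = !![a 0 0, a 0 1 * b + a 1 0 * star c; a 0 1 * c + a 1 0 * star b, a 1 1] := by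
  -- The vector e₀ is null for ψ(E₁₁) = E₁₁, and e₁ is null for ψ(E₀₀) = E₀₀; the corresponding
  -- diagonal entries off the diagonal blocks therefore vanish.
  have e1 : ψ (Matrix.single 0 1 1) 0 0 = 0 := by
    simpa using dotProduct_map_single_eq_zero h 0 1 (Pi.single 0 1) (by simp [h1])
  have e2 : ψ (Matrix.single 1 0 1) 1 1 = 0 := by
    simpa using dotProduct_map_single_eq_zero h 1 0 (Pi.single 1 1) (by simp [h0])
  have hstar := map_single_eq_conjTranspose h 0 1
  have e3 : ψ (Matrix.single 0 1 1) 1 1 = 0 := by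
    have := congr_fun₂ hstar 1 1
    rw [e2] at this
    simpa using this.symm
  have hB : ψ (Matrix.single 0 1 1) =
      !![0, ψ (Matrix.single 0 1 1) 0 1; ψ (Matrix.single 0 1 1) 1 0, 0] := by
    ext i j; fin_cases i <;> fin_cases j <;> simp [e1, e3]
  refine ⟨_, _, hB, fun a => ?_⟩
  generalize ψ (Matrix.single 0 1 1) 0 1 = b at *
  generalize ψ (Matrix.single 0 1 1) 1 0 = c at *
  rw [map_eq_sum]
  simp only [Fin.sum_univ_two, h0, h1, hstar, hB]
  ext i j; fin_cases i <;> fin_cases j <;> simp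

/-- The image of the rank one matrix of (z, 1), |z| = 1, has determinant 1 - |z b + z̄ c̄|². The
phase z is chosen to turn this modulus into |b| + |c|. -/
theorem norm_add_norm_le_one {ψ : Matrix (Fin 2) (Fin 2) ℂ →ₗ[ℂ] Matrix (Fin 2) (Fin 2) ℂ}
    (h : IsPositiveMap ψ) {b c : ℂ}
    (hψ : ∀ a, ψ a = !![a 0 0, a 0 1 * b + a 1 0 * star c; a 0 1 * c + a 1 0 * star b, a 1 1]) :
    ‖b‖ + ‖c‖ ≤ 1 := by
  obtain ⟨z, hz, hzn⟩ := exists_norm_add_eq b (star c)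
  have h1 := (h _ (Matrix.posSemidef_vecMulVec_self_star ![z, 1])).det_nonneg
  have hz' : z * (starRingEnd ℂ) z = 1 := hz
  rw [hψ, Matrix.det_fin_two] at h1
  simp [Matrix.vecMulVec_apply, hz'] at h1
  have h2 : (z * c + (starRingEnd ℂ) z * (starRingEnd ℂ) b) =
      star (z * b + star z * star c) := by
    simp; ring
  have h3 : z * b + (starRingEnd ℂ) z * (starRingEnd ℂ) c = z * b + star z * star c := rfl
  rw [h2, h3, Complex.star_def, Complex.mul_conj, Complex.normSq_eq_norm_sq] at h1
  have h4 : ‖z * b + star z * star c‖ ^ 2 ≤ 1 := by exact_mod_cast h1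
  rw [← norm_star c, ← hzn]
  exact (sq_le_one_iff₀ (norm_nonneg _)).mp h4

/-- Complete positivity makes the block matrix (ψ(Eᵢⱼ)) positive. Its 2 × 2 minor on the indices
(0,1), (1,0) has a zero on the diagonal, so the off-diagonal entry vanishes. This removes the
transposed part. -/
theorem IsCompletelyPositive.apply_single_eq_zero
    {ψ : Matrix (Fin 2) (Fin 2) ℂ →ₗ[ℂ] Matrix (Fin 2) (Fin 2) ℂ} (h : IsCompletelyPositive ψ)
    (h0 : ψ (Matrix.single 0 0 1) 1 1 = 0) : ψ (Matrix.single 0 1 1) 1 0 = 0 := by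
  have h1 := h 2 (Matrix.of fun i j => Matrix.single i j 1) (by
    have := Matrix.posSemidef_vecMulVec_self_star
      (fun p : Fin 2 × Fin 2 => if p.1 = p.2 then (1 : ℂ) else 0)
    refine (congrArg Matrix.PosSemidef ?_).mp this
    ext ⟨i, p⟩ ⟨j, q⟩
    simp only [Matrix.vecMulVec_apply, Pi.star_apply, Matrix.comp_apply, Matrix.of_apply,
      Matrix.single_apply, ite_and]
    split_ifs <;> simp)
  have h2 := (h1.submatrix ![((0 : Fin 2), (1 : Fin 2)), (1, 0)])
  have h3 := h2.det_nonneg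
  have h4 := h2.1.apply 0 1
  rw [Matrix.det_fin_two] at h3
  simp [h0] at h3 h4
  rw [← h4, ← Complex.normSq_eq_conj_mul_self] at h3
  have h5 : Complex.normSq (ψ (Matrix.single 1 0 1) 0 1) ≤ 0 := by exact_mod_cast h3
  rw [← h4, Complex.normSq_eq_zero.mp (le_antisymm h5 (Complex.normSq_nonneg _)), map_zero]

/-- The three maps send E₀₁ to β E₀₁, -β E₀₁ and γ E₁₀. Weights p, q, s must satisfy p - q = r and p
+ q + s = 1, which determines p and q. -/
theorem eq_combination {ψ : Matrix (Fin 2) (Fin 2) ℂ →ₗ[ℂ] Matrix (Fin 2) (Fin 2) ℂ}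
    {β γ : ℂ} {r s : ℝ} (hβ : β * star β = 1) (hγ : γ * star γ = 1)
    (hψ : ∀ a, ψ a = !![a 0 0, a 0 1 * (r * β) + a 1 0 * star (s * γ);
      a 0 1 * (s * γ) + a 1 0 * star (r * β), a 1 1]) :
    ψ = ((1 + r - s) / 2) • conjMap (Matrix.diagonal ![β, 1]) +
      ((1 - r - s) / 2) • conjMap (Matrix.diagonal ![-β, 1]) +
      s • conjTransposeMap (Matrix.diagonal ![1, γ]) := by
  have hβ' : β * (starRingEnd ℂ) β = 1 := hβ
  have hγ' : γ * (starRingEnd ℂ) γ = 1 := hγ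
  ext1 a
  rw [hψ]
  ext i j
  simp only [LinearMap.add_apply, LinearMap.smul_apply, conjMap_apply, conjTransposeMap_apply,
    Matrix.diagonal_conjTranspose]
  fin_cases i <;> fin_cases j <;> simp
  · linear_combination (s - 1 : ℂ) * a 0 0 * hβ'
  · ring
  · ring
  · linear_combination (-s : ℂ) * a 1 1 * hγ'

/-! ### Regular extreme maps -/

/-- Positive unital maps of `M_2` mapping the diagonal matrix units to rank one projectors are
combinations of unitary conjugations and at most one unitary conjugation of the transpose. -/
theorem exists_eq_combination {φ : Matrix (Fin 2) (Fin 2) ℂ →ₗ[ℂ] Matrix (Fin 2) (Fin 2) ℂ}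
    (h : IsPositiveMap φ) {v : Matrix (Fin 2) (Fin 2) ℂ} (hv : v * vᴴ = 1)
    (h0 : φ (Matrix.single 0 0 1) = v * Matrix.single 0 0 1 * vᴴ)
    (h1 : φ (Matrix.single 1 1 1) = v * Matrix.single 1 1 1 * vᴴ) :
    ∃ (u₁ u₂ w : Matrix (Fin 2) (Fin 2) ℂ) (r₁ r₂ s : ℝ), u₁ * u₁ᴴ = 1 ∧ u₂ * u₂ᴴ = 1 ∧
      w * wᴴ = 1 ∧ 0 ≤ r₁ ∧ 0 ≤ r₂ ∧ 0 ≤ s ∧ r₁ + r₂ + s = 1 ∧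
      φ = r₁ • conjMap u₁ + r₂ • conjMap u₂ + s • conjTransposeMap w ∧
      (IsCompletelyPositive φ → s = 0) := by
  have hv' : vᴴ * v = 1 := mul_eq_one_comm.mp hv
  -- Undoing v yields a positive map that fixes E₀₀ and E₁₁.
  set ψ := conjMap vᴴ ∘ₗ φ with hψdef
  have hψ : IsPositiveMap ψ := fun a ha => (isCompletelyPositive_conjMap vᴴ).isPositiveMap _ (h a ha)
  have hcancel (a : Matrix (Fin 2) (Fin 2) ℂ) : conjMap vᴴ (v * a * vᴴ) = a := by
    rw [conjMap_apply, Matrix.conjTranspose_conjTranspose]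
    calc vᴴ * (v * a * vᴴ) * v = (vᴴ * v) * a * (vᴴ * v) := by simp only [mul_assoc]
      _ = a := by rw [hv', one_mul, mul_one]
  have hφψ : φ = conjMap v ∘ₗ ψ := by
    ext1 a
    simp only [hψdef, LinearMap.comp_apply, conjMap_apply, Matrix.conjTranspose_conjTranspose]
    calc φ a = (v * vᴴ) * φ a * (v * vᴴ) := by rw [hv, one_mul, mul_one]
      _ = _ := by simp only [mul_assoc]
  have e0 : ψ (Matrix.single 0 0 1) = Matrix.single 0 0 1 := by
    rw [hψdef, LinearMap.comp_apply, h0, hcancel]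
  have e1 : ψ (Matrix.single 1 1 1) = Matrix.single 1 1 1 := by
    rw [hψdef, LinearMap.comp_apply, h1, hcancel]
  obtain ⟨b, c, hB, hform⟩ := exists_map_single_eq hψ e0 e1
  have hle := norm_add_norm_le_one hψ hform
  obtain ⟨β, hβ, hbβ⟩ := exists_norm_eq_one_mul_norm b
  obtain ⟨γ, hγ, hcγ⟩ := exists_norm_eq_one_mul_norm c
  have hcomb := eq_combination (r := ‖b‖) (s := ‖c‖) hβ hγ (by rwa [← hbβ, ← hcγ])
  refine ⟨v * Matrix.diagonal ![β, 1], v * Matrix.diagonal ![-β, 1],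
    v * Matrix.diagonal ![1, γ], (1 + ‖b‖ - ‖c‖) / 2, (1 - ‖b‖ - ‖c‖) / 2, ‖c‖,
    mul_diagonal_unitary hv hβ (by simp), mul_diagonal_unitary hv (by simpa using hβ) (by simp),
    mul_diagonal_unitary hv (by simp) hγ, by linarith [norm_nonneg b], by linarith,
    norm_nonneg c, by ring, ?_, fun hcp => ?_⟩
  · rw [hφψ, hcomb]
    ext1 a
    simp only [LinearMap.comp_apply, LinearMap.add_apply, LinearMap.smul_apply, map_add,
      LinearMap.map_smul_of_tower]
    simp only [conjMap_apply, conjTransposeMap_apply, Matrix.conjTranspose_mul, mul_assoc]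
  · have hψcp : IsCompletelyPositive ψ := fun k A hA =>
      isCompletelyPositive_conjMap vᴴ k _ (hcp k A hA)
    have := hψcp.apply_single_eq_zero (by rw [e0]; simp)
    rw [hB] at this
    simpa using this

/-- The first three families already suffice: the block diagonal family is never reached by a
regular extreme map. -/
theorem IsRegularExtreme.choi_mem
    {φ : Matrix (Fin 2) (Fin 2) ℂ →ₗ[ℂ] Matrix (Fin 2) (Fin 2) ℂ} (h : IsRegularExtreme φ) :
    choi φ ∈ setDTilde (Fin 2) := by
  obtain ⟨hext, hdiag⟩ := h
  obtain ⟨hpos, hone⟩ : IsPositiveMap φ ∧ φ 1 = 1 := by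
    rcases hext with h | h
    · exact ⟨h.1.1, h.1.2.1⟩
    · exact ⟨h.1.1.isPositiveMap, h.1.2.1⟩
  have hsum : (1 : Matrix (Fin 2) (Fin 2) ℂ) = Matrix.single 0 0 1 + Matrix.single 1 1 1 := by
    ext i j; fin_cases i <;> fin_cases j <;> simp
  have h1 : φ (Matrix.single 1 1 1) = 1 - φ (Matrix.single 0 0 1) := by
    rw [← hone, ← map_sub]
    exact congrArg φ (by rw [hsum]; abel)
  have hpsd (i : Fin 2) : (φ (Matrix.single i i 1)).PosSemidef := by
    refine hpos _ ?_
    have := Matrix.posSemidef_vecMulVec_self_star (Pi.single i (1 : ℂ))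
    rwa [Pi.star_single, star_one, ← Matrix.single_eq_single_vecMulVec_single] at this
  rw [comp_val_eq_diagonalMap h1] at hdiag
  have hidem := isIdempotentElem_of_diagonalMap_mem_extremePoints (hpsd 0) (h1 ▸ hpsd 1) hdiag
  rcases exists_unitary_of_isIdempotentElem (hpsd 0).1 hidem with h0 | h0 | ⟨v, hv, h0⟩
  · rw [choi_eq_kronecker_one hpos (by decide : (1 : Fin 2) ≠ 0) (by rw [h1, h0, sub_zero]) h0]
    exact Or.inr ⟨_, isRankOneProjector_single 1, rfl⟩
  · rw [choi_eq_kronecker_one hpos (by decide : (0 : Fin 2) ≠ 1) h0 (by rw [h1, h0, sub_self])]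
    exact Or.inr ⟨_, isRankOneProjector_single 0, rfl⟩
  · have h1' : φ (Matrix.single 1 1 1) = v * Matrix.single 1 1 1 * vᴴ := by
      rw [h1, h0, sub_eq_iff_eq_add, ← add_mul, ← mul_add, add_comm, ← hsum, mul_one, hv]
    obtain ⟨u₁, u₂, w, r₁, r₂, s, hu₁, hu₂, hw, hr₁, hr₂, hs, hrs, hφ, hcp⟩ :=
      exists_eq_combination hpos hv h0 h1'
    rcases hext with hext | hext
    · have hmem : φ ∈ ({conjMap u₁, conjMap u₂, conjTransposeMap w} : Set _) := by
        refine mem_of_mem_extremePoints convex_positiveMaps ?_ hext ?_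
        · rintro _ (rfl | rfl | rfl)
          exacts [conjMap_mem_positiveMaps hu₁, conjMap_mem_positiveMaps hu₂,
            conjTransposeMap_mem_positiveMaps hw]
        · have hc := (convex_convexHull ℝ
            ({conjMap u₁, conjMap u₂, conjTransposeMap w} : Set _)).sum_mem
            (t := Finset.univ) (w := ![r₁, r₂, s]) (z := ![conjMap u₁, conjMap u₂,
              conjTransposeMap w]) (by intro i _; fin_cases i <;> assumption)
            (by simpa [Fin.sum_univ_three] using hrs)
            (by intro i _; refine subset_convexHull ℝ _ ?_; fin_cases i <;> simp)
          simpa [Fin.sum_univ_three, ← hφ] using hc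
      rcases hmem with rfl | rfl | rfl
      exacts [choi_conjMap_mem_setDTilde hu₁, choi_conjMap_mem_setDTilde hu₂,
        choi_conjTransposeMap_mem_setDTilde hw]
    -- Extremality is now relative to completely positive maps, so the transposed term must be
    -- removed before the decomposition can be used.
    · have hs0 := hcp hext.1.1
      have hmem : φ ∈ ({conjMap u₁, conjMap u₂} : Set _) := by
        refine mem_of_mem_extremePoints convex_completelyPositiveMaps ?_ hext ?_
        · rintro _ (rfl | rfl)
          exacts [conjMap_mem_completelyPositiveMaps hu₁, conjMap_mem_completelyPositiveMaps hu₂]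
        · rw [convexHull_pair]
          exact ⟨r₁, r₂, hr₁, hr₂, by linarith, by rw [hφ, hs0, zero_smul, add_zero]⟩
      rcases hmem with rfl | rfl
      exacts [choi_conjMap_mem_setDTilde hu₁, choi_conjMap_mem_setDTilde hu₂]

end RegularExtreme

theorem mainTheorem2 :
    (RegularExtreme.setDTilde (Fin 2) ∪ Set.range (RegularExtreme.diagonalChoi (n := Fin 2)) ⊆
      RegularExtreme.setD (Fin 2)) ∧
    ∀ φ : Matrix (Fin 2) (Fin 2) ℂ →ₗ[ℂ] Matrix (Fin 2) (Fin 2) ℂ,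
      RegularExtreme.IsRegularExtreme φ →
        RegularExtreme.choi φ ∈
          RegularExtreme.setDTilde (Fin 2) ∪
            Set.range (RegularExtreme.diagonalChoi (n := Fin 2)) :=
  ⟨RegularExtreme.union_subset_setD, fun _ h => Or.inl h.choi_mem⟩
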